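/- Let $R$ be a commutative Noetherian local ring that is Cohen–Macaulay (CM) of Krull dimension $d$, let $I \subsetneq R$ be a proper ideal, and for $a,b\in R$ let $$R(I)_{a,b} = \mathcal R_+ / \bigl((t^2+at+b)R[t]\cap \mathcal R_+\bigr), \qquad \mathcal R_+=\bigoplus_{n\ge 0} I^n t^n\subseteq R[t],$$ be the quotient of the Rees algebra of $I$ by the contraction of the ideal of $R[t]$ generated by $t^2+at+b$. If $I\neq 0$, then for all $a,b\in R$ the ring $R(I)_{a,b}$ is Cohen–Macaulay if and only if $I$ is a Cohen–Macaulay $R$-module of dimension $d$ (that is, a maximal Cohen–Macaulay $R$-module). In particular, whether $R(I)_{a,b}$ is Cohen–Macaulay depends only on $I$: for every proper ideal $I$ and all $a,b,a',b'\in R$, the ring $R(I)_{a,b}$ is Cohen–Macaulay if and only if $R(I)_{a',b'}$ is. Here a Cohen–Macaulay module over a Noetherian local ring is a nonzero finitely generated module whose depth equals its Krull dimension, and a Cohen–Macaulay ring is a Noetherian ring whose localization at each maximal ideal is Cohen–Macaulay as a module over itself. -/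

import Mathlib

open Polynomial

noncomputable section

/-- The ring `R(I)_{a,b}`: the quotient of the Rees algebra `⨁ₙ Iⁿ tⁿ ⊆ R[t]` by the contraction
of the ideal of `R[t]` generated by `t² + a t + b`. -/
abbrev ReesQuotient {R : Type*} [CommRing R] (I : Ideal R) (a b : R) : Type _ :=
  reesAlgebra I ⧸ (Ideal.span {(X ^ 2 + C a * X + C b : R[X])}).comap (reesAlgebra I).val

/-- The depth of a (nonzero, finitely generated) module `M` over a (Noetherian) local ring `R`:
the supremum of the lengths of the `M`-regular sequences contained in the maximal ideal. -/
def localDepth (R : Type*) [CommRing R] [IsLocalRing R]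
    (M : Type*) [AddCommGroup M] [Module R M] : ℕ∞ :=
  ⨆ rs : {rs : List R //
      (∀ r ∈ rs, r ∈ IsLocalRing.maximalIdeal R) ∧ RingTheory.Sequence.IsRegular M rs},
    (rs.1.length : ℕ∞)

/-- A Cohen–Macaulay module over a (Noetherian) local ring: a nonzero finitely generated module
whose depth is equal to its Krull dimension. -/
structure IsCohenMacaulayModule (R : Type*) [CommRing R] [IsLocalRing R]
    (M : Type*) [AddCommGroup M] [Module R M] : Prop where
  finite : Module.Finite R M
  nontrivial : Nontrivial M
  depth_eq_dim : (localDepth R M : WithBot ℕ∞) = Module.supportDim R M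

/-- A Cohen–Macaulay ring: a Noetherian ring whose localization at each maximal ideal is
Cohen–Macaulay as a module over itself. -/
structure IsCohenMacaulayRing (R : Type*) [CommRing R] : Prop where
  noetherian : IsNoetherianRing R
  localization : ∀ (m : Ideal R) [m.IsMaximal],
    IsCohenMacaulayModule (Localization.AtPrime m) (Localization.AtPrime m)

end

/-! Division by the monic `t² + at + b` identifies `T = R(I)_{a,b}` with `R ⊕ I` as an `R`-module,
for all `a`, `b`. Since `(it)² = -i(ib + ait)` and `I ⊆ 𝔪`, the ring `T` is local, finite over `R`,
of dimension `d`, and its maximal ideal is the radical of `𝔪T`. Regular sequences on `T` can then be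
taken from `𝔪` (`hasRegularSeq_restrictScalars_iff`), so `T` is Cohen–Macaulay iff `𝔪` contains
regular sequences of length `d` on both `R` and `I` (`HasRegularSeq.prod_iff`). The condition on `R`
is given. The depth facts rest on `HasRegularSeq.addSMulTop_of_isRegularMod`, proved by prime
avoidance and an exchange of socles. -/

/-! ### Exchange of regular sequences -/

section RegularElements

variable {A : Type*} [CommRing A] {M M' : Type*} [AddCommGroup M] [Module A M]
  [AddCommGroup M'] [Module A M']

/-- Multiplication by `x` is injective on the quotient `M ⧸ N`. -/
def IsRegularMod (x : A) (N : Submodule A M) : Prop :=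
  ∀ u : M, x • u ∈ N → u ∈ N

/-- The submodule `N + xM` of `M`. -/
def addSMulTop (N : Submodule A M) (x : A) : Submodule A M :=
  N ⊔ LinearMap.range (LinearMap.lsmul A M x)

theorem mem_addSMulTop {N : Submodule A M} {x : A} {u : M} :
    u ∈ addSMulTop N x ↔ ∃ n ∈ N, ∃ v : M, n + x • v = u := by
  simp [addSMulTop, Submodule.mem_sup]

theorem mem_addSMulTop' {N : Submodule A M} {x : A} {u : M} :
    u ∈ addSMulTop N x ↔ ∃ v : M, u - x • v ∈ N := by
  rw [mem_addSMulTop]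
  constructor
  · rintro ⟨n, hn, v, rfl⟩
    exact ⟨v, by simpa using hn⟩
  · rintro ⟨v, hv⟩
    exact ⟨_, hv, v, by simp⟩

theorem addSMulTop_comm (N : Submodule A M) (x y : A) :
    addSMulTop (addSMulTop N x) y = addSMulTop (addSMulTop N y) x := by
  simp only [addSMulTop, sup_right_comm]

theorem addSMulTop_prod (N : Submodule A M) (N' : Submodule A M') (x : A) :
    addSMulTop (N.prod N') x = (addSMulTop N x).prod (addSMulTop N' x) := by
  ext ⟨u, u'⟩
  simp only [mem_addSMulTop', Submodule.mem_prod]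
  constructor
  · rintro ⟨⟨v, v'⟩, h, h'⟩
    exact ⟨⟨v, h⟩, ⟨v', h'⟩⟩
  · rintro ⟨⟨v, h⟩, ⟨v', h'⟩⟩
    exact ⟨(v, v'), h, h'⟩

theorem isRegularMod_prod {N : Submodule A M} {N' : Submodule A M'} {x : A} :
    IsRegularMod x (N.prod N') ↔ IsRegularMod x N ∧ IsRegularMod x N' := by
  constructor
  · intro h
    exact ⟨fun u hu => (h (u, 0) (by simpa using hu)).1,
      fun u hu => (h (0, u) (by simpa using hu)).2⟩
  · rintro ⟨h, h'⟩ ⟨u, u'⟩ hu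
    exact ⟨h u hu.1, h' u' hu.2⟩

theorem isRegularMod_iff_isSMulRegular {N : Submodule A M} {x : A} :
    IsRegularMod x N ↔ IsSMulRegular (M ⧸ N) x :=
  (isSMulRegular_quotient_iff_mem_of_smul_mem N x).symm

theorem IsRegularMod.pow {N : Submodule A M} {x : A} (h : IsRegularMod x N) (k : ℕ) :
    IsRegularMod (x ^ k) N := by
  rw [isRegularMod_iff_isSMulRegular] at h ⊢
  exact h.pow k

/-- No element of `M ⧸ N` other than zero is annihilated by `J`. -/
def NoSocle (J : Ideal A) (N : Submodule A M) : Prop :=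
  ∀ u : M, (∀ r ∈ J, r • u ∈ N) → u ∈ N

theorem NoSocle.prod {J : Ideal A} {N : Submodule A M} {N' : Submodule A M'}
    (h : NoSocle J N) (h' : NoSocle J N') : NoSocle J (N.prod N') :=
  fun u hu => ⟨h u.1 fun r hr => (hu r hr).1, h' u.2 fun r hr => (hu r hr).2⟩

theorem NoSocle.of_isRegularMod {J : Ideal A} {N : Submodule A M} {x : A} (hx : x ∈ J)
    (h : IsRegularMod x N) : NoSocle J N :=
  fun u hu => h u (hu x hx)

/-- An ideal consisting of zero divisors on a finite module annihilates a nonzero element. -/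
theorem NoSocle.exists_isRegularMod [IsNoetherianRing A] [Module.Finite A M] {J : Ideal A}
    {N : Submodule A M} (h : NoSocle J N) : ∃ x ∈ J, IsRegularMod x N := by
  by_contra! hJ
  have hsub : (J : Set A) ⊆ ⋃ p ∈ associatedPrimes A (M ⧸ N), (p : Set A) := by
    rw [biUnion_associatedPrimes_eq_compl_regular A (M ⧸ N)]
    intro x hx hreg
    exact hJ x hx (isRegularMod_iff_isSMulRegular.2 hreg)
  obtain ⟨p, hp, hJp⟩ := (Ideal.subset_union_prime_finite (f := id)
    (associatedPrimes.finite A (M ⧸ N)) ⊥ ⊥ fun _ hp _ _ => hp.isPrime).1 hsub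
  obtain ⟨hprime, v, rfl⟩ := isAssociatedPrime_iff.1 hp
  obtain ⟨u, rfl⟩ := N.mkQ_surjective v
  have hu : u ∈ N := h u fun r hr => by
    simpa [Submodule.mem_colon_singleton, ← Submodule.Quotient.mk_smul] using hJp hr
  exact hprime.ne_top (by
    rw [Ideal.eq_top_iff_one, Submodule.mem_colon_singleton]
    simpa using hu)

/-- If `x` and `y` are both regular modulo `N`, the socles of `M ⧸ (N + xM)` and `M ⧸ (N + yM)`
vanish simultaneously. -/
theorem NoSocle.exchange {J : Ideal A} {N : Submodule A M} {x y : A}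
    (hx : IsRegularMod x N) (hy : IsRegularMod y N) (hyJ : y ∈ J)
    (h : NoSocle J (addSMulTop N y)) : NoSocle J (addSMulTop N x) := by
  intro u hu
  -- Modulo `N`, `y u = x v`; sending `u` to `v` carries the socle for `x` to the socle for `y`.
  obtain ⟨v, hv⟩ := mem_addSMulTop'.1 (hu y hyJ)
  have hvy : v ∈ addSMulTop N y := by
    refine h v fun r hr => ?_
    obtain ⟨w, hw⟩ := mem_addSMulTop'.1 (hu r hr)
    refine mem_addSMulTop'.2 ⟨w, hx _ ?_⟩
    have : x • (r • v - y • w) = y • (r • u - x • w) - r • (y • u - x • v) := by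
      module
    rw [this]
    exact N.sub_mem (N.smul_mem _ hw) (N.smul_mem _ hv)
  obtain ⟨w, hw⟩ := mem_addSMulTop'.1 hvy
  refine mem_addSMulTop'.2 ⟨w, hy _ ?_⟩
  have : y • (u - x • w) = (y • u - x • v) + x • (v - y • w) := by module
  rw [this]
  exact N.add_mem hv (N.smul_mem _ hw)

/-- This half of permuting a regular sequence needs no Nakayama argument. -/
theorem IsRegularMod.swap {N : Submodule A M} {x z : A} (hx : IsRegularMod x N)
    (hz : IsRegularMod z (addSMulTop N x)) : IsRegularMod x (addSMulTop N z) := by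
  intro u hu
  obtain ⟨v, hv⟩ := mem_addSMulTop'.1 hu
  have hvx : v ∈ addSMulTop N x := by
    refine hz v (mem_addSMulTop'.2 ⟨u, ?_⟩)
    rw [← neg_sub]
    exact N.neg_mem hv
  obtain ⟨w, hw⟩ := mem_addSMulTop'.1 hvx
  refine mem_addSMulTop'.2 ⟨w, hx _ ?_⟩
  have : x • (u - z • w) = (x • u - z • v) + z • (v - x • w) := by module
  rw [this]
  exact N.add_mem hv (N.smul_mem _ hw)

/-- The ideal `J` contains a weakly regular sequence of length `n` on `M ⧸ N`. -/
def HasRegularSeq (J : Ideal A) : ℕ → Submodule A M → Prop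
  | 0, _ => True
  | n + 1, N => ∃ x ∈ J, IsRegularMod x N ∧ HasRegularSeq J n (addSMulTop N x)

/-- Any element of `J` that is regular modulo `N` starts a regular sequence of maximal length. -/
theorem HasRegularSeq.addSMulTop_of_isRegularMod [IsNoetherianRing A] [Module.Finite A M]
    {J : Ideal A} {n : ℕ} {N : Submodule A M} (h : HasRegularSeq J (n + 1) N) {x : A}
    (hxJ : x ∈ J) (hx : IsRegularMod x N) : HasRegularSeq J n (addSMulTop N x) := by
  induction n generalizing N x with
  | zero => trivial
  | succ n ih =>
    obtain ⟨y, hyJ, hy, hyn⟩ := h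
    obtain ⟨w, hwJ, hw, -⟩ := id hyn
    have hNy : NoSocle J (addSMulTop N y) := .of_isRegularMod hwJ hw
    have hNx : NoSocle J (addSMulTop N x) := hNy.exchange hx hy hyJ
    -- `z` can follow both `x` and `y`: the sequence `y, z, …` becomes `z, y, …`, then `z, x, …`,
    -- then `x, z, …`.
    obtain ⟨z, hzJ, hz⟩ := (hNx.prod hNy).exists_isRegularMod
    obtain ⟨hzx, hzy⟩ := isRegularMod_prod.1 hz
    have h1 := ih hyn hzJ hzy
    rw [addSMulTop_comm] at h1
    have h2 := ih (N := addSMulTop N z) ⟨y, hyJ, hy.swap hzy, h1⟩ hxJ (hx.swap hzx)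
    rw [addSMulTop_comm] at h2
    exact ⟨z, hzJ, hzx, h2⟩

/-- Prime avoidance gives a first element regular on both factors at once, and by exchange it costs
no length on either. -/
theorem HasRegularSeq.prod_iff [IsNoetherianRing A] [Module.Finite A M] [Module.Finite A M']
    {J : Ideal A} {n : ℕ} {N : Submodule A M} {N' : Submodule A M'} :
    HasRegularSeq J n (N.prod N') ↔ HasRegularSeq J n N ∧ HasRegularSeq J n N' := by
  induction n generalizing N N' with
  | zero => simp [HasRegularSeq]
  | succ n ih =>
    constructor
    · rintro ⟨x, hxJ, hx, h⟩
      rw [addSMulTop_prod, ih] at h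
      rw [isRegularMod_prod] at hx
      exact ⟨⟨x, hxJ, hx.1, h.1⟩, ⟨x, hxJ, hx.2, h.2⟩⟩
    · rintro ⟨h, h'⟩
      obtain ⟨y, hyJ, hy, -⟩ := id h
      obtain ⟨y', hyJ', hy', -⟩ := id h'
      obtain ⟨x, hxJ, hx⟩ :=
        ((NoSocle.of_isRegularMod hyJ hy).prod (.of_isRegularMod hyJ' hy')).exists_isRegularMod
      refine ⟨x, hxJ, hx, ?_⟩
      rw [isRegularMod_prod] at hx
      rw [addSMulTop_prod, ih]
      exact ⟨h.addSMulTop_of_isRegularMod hxJ hx.1, h'.addSMulTop_of_isRegularMod hxJ hx.2⟩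

open scoped Pointwise in
/-- The quotient of `M ⧸ N` by `x` is `M ⧸ (N + xM)`. -/
noncomputable def quotSMulTopQuotientEquiv (N : Submodule A M) (x : A) :
    QuotSMulTop x (M ⧸ N) ≃ₗ[A] M ⧸ addSMulTop N x :=
  Submodule.quotEquivOfEq _ _ (by
      rw [Submodule.map_pointwise_smul, Submodule.map_top, Submodule.range_mkQ]) ≪≫ₗ
    Submodule.quotientQuotientEquivQuotientSup N (x • ⊤) ≪≫ₗ
    Submodule.quotEquivOfEq _ _ (by
      ext u
      simp [addSMulTop, Submodule.mem_sup, Submodule.mem_smul_pointwise_iff_exists])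

open RingTheory.Sequence in
theorem hasRegularSeq_iff {J : Ideal A} {n : ℕ} {N : Submodule A M} :
    HasRegularSeq J n N ↔
      ∃ rs : List A, rs.length = n ∧ (∀ r ∈ rs, r ∈ J) ∧ IsWeaklyRegular (M ⧸ N) rs := by
  induction n generalizing N with
  | zero => simp [HasRegularSeq]
  | succ n ih =>
    constructor
    · rintro ⟨x, hxJ, hx, h⟩
      obtain ⟨rs, hlen, hrs, hreg⟩ := ih.1 h
      refine ⟨x :: rs, by simp [hlen], by simpa using ⟨hxJ, hrs⟩, ?_⟩
      rw [isWeaklyRegular_cons_iff]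
      exact ⟨isRegularMod_iff_isSMulRegular.1 hx,
        ((quotSMulTopQuotientEquiv N x).isWeaklyRegular_congr rs).2 hreg⟩
    · rintro ⟨rs, hlen, hrs, hreg⟩
      obtain _ | ⟨x, rs⟩ := rs
      · simp at hlen
      rw [isWeaklyRegular_cons_iff] at hreg
      simp only [List.mem_cons, forall_eq_or_imp] at hrs
      exact ⟨x, hrs.1, isRegularMod_iff_isSMulRegular.2 hreg.1, ih.2 ⟨rs, by simpa using hlen,
        hrs.2, ((quotSMulTopQuotientEquiv N x).isWeaklyRegular_congr rs).1 hreg.2⟩⟩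

open RingTheory.Sequence in
theorem hasRegularSeq_bot_iff {J : Ideal A} {n : ℕ} :
    HasRegularSeq J n (⊥ : Submodule A M) ↔
      ∃ rs : List A, rs.length = n ∧ (∀ r ∈ rs, r ∈ J) ∧ IsWeaklyRegular M rs := by
  rw [hasRegularSeq_iff]
  simp only [(Submodule.quotEquivOfEqBot (⊥ : Submodule A M) rfl).isWeaklyRegular_congr]

theorem LinearEquiv.hasRegularSeq_bot_iff (e : M ≃ₗ[A] M') {J : Ideal A} {n : ℕ} :
    HasRegularSeq J n (⊥ : Submodule A M) ↔ HasRegularSeq J n (⊥ : Submodule A M') := by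
  simp only [_root_.hasRegularSeq_bot_iff, e.isWeaklyRegular_congr]

end RegularElements

/-! ### Regular sequences over a finite algebra -/

section RestrictScalars

variable {A B : Type*} [CommRing A] [CommRing B] [Algebra A B] {M : Type*} [AddCommGroup M]
  [Module A M] [Module B M] [IsScalarTower A B M]

theorem isRegularMod_restrictScalars {N : Submodule B M} {x : A} :
    IsRegularMod x (N.restrictScalars A) ↔ IsRegularMod (algebraMap A B x) N := by
  simp [IsRegularMod]

theorem addSMulTop_restrictScalars (N : Submodule B M) (x : A) :
    addSMulTop (N.restrictScalars A) x =
      (addSMulTop N (algebraMap A B x)).restrictScalars A := by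
  ext u
  simp [mem_addSMulTop']

/-- Regular sequences on a module over a finite algebra can be taken from the base ring. -/
theorem hasRegularSeq_restrictScalars_iff [IsNoetherianRing A] [IsNoetherianRing B]
    [Module.Finite A M] [Module.Finite B M] {J : Ideal A} {K : Ideal B}
    (hJK : J.map (algebraMap A B) ≤ K) (hKJ : K ≤ (J.map (algebraMap A B)).radical)
    {n : ℕ} {N : Submodule B M} :
    HasRegularSeq J n (N.restrictScalars A) ↔ HasRegularSeq K n N := by
  have hJK' : ∀ x ∈ J, algebraMap A B x ∈ K := fun x hx => hJK (Ideal.mem_map_of_mem _ hx)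
  induction n generalizing N with
  | zero => simp [HasRegularSeq]
  | succ n ih =>
    constructor
    · rintro ⟨x, hxJ, hx, h⟩
      rw [addSMulTop_restrictScalars] at h
      exact ⟨_, hJK' x hxJ, isRegularMod_restrictScalars.1 hx, ih.1 h⟩
    · intro h
      obtain ⟨y, hyK, hy, -⟩ := id h
      obtain ⟨k, hk⟩ := hKJ hyK
      -- What `J` kills modulo `N` is killed by the ideal `J` generates in `B`, hence by the regular
      -- element `y ^ k`.
      have hsoc : NoSocle J (N.restrictScalars A) := by
        intro u hu
        refine (NoSocle.of_isRegularMod hk (hy.pow k)) u fun r hr => ?_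
        let S : Ideal B := N.comap (LinearMap.toSpanSingleton B M u)
        have hS : J.map (algebraMap A B) ≤ S :=
          Ideal.map_le_iff_le_comap.2 fun r hr => by simpa [S] using hu r hr
        simpa [S] using hS hr
      obtain ⟨x, hxJ, hx⟩ := hsoc.exists_isRegularMod
      refine ⟨x, hxJ, hx, ?_⟩
      rw [addSMulTop_restrictScalars]
      exact ih.2 (h.addSMulTop_of_isRegularMod (hJK' x hxJ) (isRegularMod_restrictScalars.1 hx))

end RestrictScalars

/-! ### Cohen–Macaulayness as a regular sequence of length `d` -/

section CohenMacaulay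

open IsLocalRing RingTheory.Sequence

variable {A : Type*} [CommRing A] [IsLocalRing A]
  {M : Type*} [AddCommGroup M] [Module A M] [Module.Finite A M]

theorem length_le_supportDim_of_isRegular [IsNoetherianRing A] {rs : List A} (h : IsRegular M rs) :
    (rs.length : WithBot ℕ∞) ≤ Module.supportDim A M := by
  rw [← Module.supportDim_add_length_eq_supportDim_of_isRegular rs h]
  have : Nontrivial (M ⧸ Ideal.ofList rs • (⊤ : Submodule A M)) :=
    h.quot_ofList_smul_nontrivial ⊤
  have h0 : (0 : WithBot ℕ∞) ≤
      Module.supportDim A (M ⧸ Ideal.ofList rs • (⊤ : Submodule A M)) := by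
    have := Module.supportDim_ne_bot_of_nontrivial A
      (M ⧸ Ideal.ofList rs • (⊤ : Submodule A M))
    obtain ⟨k, hk⟩ := WithBot.ne_bot_iff_exists.1 this
    rw [← hk]
    exact_mod_cast zero_le
  simpa using add_le_add_left h0 (rs.length : WithBot ℕ∞)

theorem HasRegularSeq.exists_isRegular [Nontrivial M] {n : ℕ}
    (h : HasRegularSeq (maximalIdeal A) n (⊥ : Submodule A M)) :
    ∃ rs : List A, rs.length = n ∧ (∀ r ∈ rs, r ∈ maximalIdeal A) ∧ IsRegular M rs := by
  obtain ⟨rs, hlen, hrs, hreg⟩ := hasRegularSeq_bot_iff.1 h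
  exact ⟨rs, hlen, hrs, .of_isWeaklyRegular_of_mem_maximalIdeal M hrs hreg⟩

variable [IsNoetherianRing A]

theorem HasRegularSeq.le_supportDim [Nontrivial M] {n : ℕ}
    (h : HasRegularSeq (maximalIdeal A) n (⊥ : Submodule A M)) :
    (n : WithBot ℕ∞) ≤ Module.supportDim A M := by
  obtain ⟨rs, rfl, -, hreg⟩ := h.exists_isRegular
  exact length_le_supportDim_of_isRegular hreg

theorem isCohenMacaulayModule_iff_hasRegularSeq [Nontrivial M] {d : ℕ}
    (hd : Module.supportDim A M = d) :
    IsCohenMacaulayModule A M ↔ HasRegularSeq (maximalIdeal A) d (⊥ : Submodule A M) := by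
  have hle : ∀ rs : {rs : List A // (∀ r ∈ rs, r ∈ maximalIdeal A) ∧ IsRegular M rs},
      rs.1.length ≤ d := fun rs => by
    have := length_le_supportDim_of_isRegular rs.2.2
    rw [hd] at this
    exact_mod_cast this
  constructor
  · intro h
    have hdepth : localDepth A M = d := by
      have := h.depth_eq_dim
      rw [hd] at this
      exact_mod_cast this
    -- The supremum is attained: were there no sequence of length `k + 1`, the depth would be at
    -- most `k`.
    obtain _ | k := d
    · trivial
    by_contra hno
    have hlt : ∀ rs : {rs : List A // (∀ r ∈ rs, r ∈ maximalIdeal A) ∧ IsRegular M rs},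
        rs.1.length ≤ k := fun rs => Nat.le_of_lt_succ <| (hle rs).lt_of_ne fun heq =>
      hno (hasRegularSeq_bot_iff.2 ⟨rs.1, heq, rs.2.1, rs.2.2.toIsWeaklyRegular⟩)
    have : localDepth A M ≤ k := iSup_le fun rs => by exact_mod_cast hlt rs
    rw [hdepth] at this
    have : k + 1 ≤ k := by exact_mod_cast this
    omega
  · intro h
    refine ⟨inferInstance, inferInstance, ?_⟩
    obtain ⟨rs, hlen, hrs, hreg⟩ := h.exists_isRegular
    rw [hd]
    have : localDepth A M = d := by
      refine le_antisymm (iSup_le fun rs => by exact_mod_cast hle rs) ?_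
      rw [← hlen]
      exact le_iSup (fun rs : {rs : List A //
        (∀ r ∈ rs, r ∈ maximalIdeal A) ∧ IsRegular M rs} => (rs.1.length : ℕ∞)) ⟨rs, hrs, hreg⟩
    rw [this]
    rfl

theorem isCohenMacaulayRing_iff_hasRegularSeq {d : ℕ} (hd : ringKrullDim A = d) :
    IsCohenMacaulayRing A ↔ HasRegularSeq (maximalIdeal A) d (⊥ : Submodule A A) := by
  let e : A ≃ₐ[A] Localization.AtPrime (maximalIdeal A) :=
    IsLocalization.atUnits A (maximalIdeal A).primeCompl fun x hx => by
      simpa [Ideal.primeCompl, IsUnit.mem_submonoid_iff] using hx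
  have : Module.Finite A (Localization.AtPrime (maximalIdeal A)) :=
    Module.Finite.equiv e.toLinearEquiv
  have hN : IsNoetherianRing (Localization.AtPrime (maximalIdeal A)) :=
    isNoetherianRing_of_ringEquiv A e.toRingEquiv
  have hmap : (maximalIdeal A).map (algebraMap A (Localization.AtPrime (maximalIdeal A))) =
      maximalIdeal _ := Localization.AtPrime.map_eq_maximalIdeal
  have hdim : Module.supportDim (Localization.AtPrime (maximalIdeal A))
      (Localization.AtPrime (maximalIdeal A)) = d := by
    rw [Module.supportDim_self_eq_ringKrullDim, ← ringKrullDim_eq_of_ringEquiv e.toRingEquiv, hd]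
  have key : HasRegularSeq (maximalIdeal A) d (⊥ : Submodule A A) ↔
      IsCohenMacaulayModule (Localization.AtPrime (maximalIdeal A))
        (Localization.AtPrime (maximalIdeal A)) := by
    rw [isCohenMacaulayModule_iff_hasRegularSeq hdim, e.toLinearEquiv.hasRegularSeq_bot_iff,
      ← hasRegularSeq_restrictScalars_iff hmap.le (hmap.ge.trans Ideal.le_radical),
      Submodule.restrictScalars_bot]
  rw [key]
  constructor
  · intro h
    exact h.localization (maximalIdeal A)
  · intro h
    refine ⟨inferInstance, fun m hm => ?_⟩
    obtain rfl := IsLocalRing.eq_maximalIdeal hm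
    exact h

end CohenMacaulay

/-! ### Dimension and finite extensions of the form `R ⊕ I` -/

section Integral

variable {A B : Type*} [CommRing A] [CommRing B] [Algebra A B] [Algebra.IsIntegral A B]

/-- An injective integral extension preserves the Krull dimension. -/
theorem ringKrullDim_eq_of_isIntegral (hinj : Function.Injective (algebraMap A B)) :
    ringKrullDim B = ringKrullDim A := by
  apply le_antisymm
  · refine Order.krullDim_le_of_strictMono (PrimeSpectrum.comap (algebraMap A B)) fun P Q h => ?_
    exact Ideal.IsIntegral.comap_lt_comap (A := B) (R := A) h
  · have : FaithfulSMul A B := (faithfulSMul_iff_algebraMap_injective A B).2 hinj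
    refine iSup_le fun l => ?_
    obtain ⟨P, hP, hl⟩ := Ideal.nonempty_primesOver (S := B) l.head.asIdeal
    obtain ⟨L, hL, -⟩ := Ideal.exists_ltSeries_of_hasGoingUp l P
    rw [← hL]
    exact Order.LTSeries.length_le_krullDim L

end Integral

section FiniteExtension

open IsLocalRing

variable {R T : Type*} [CommRing R] [IsLocalRing R] [IsNoetherianRing R] [CommRing T] [Algebra R T]
  {I : Ideal R} (e : (R × I) ≃ₗ[R] T)

/-- Let `T` be an `R`-algebra which is `R ⊕ I` as an `R`-module, such that the elements of `I` have
squares in the extension of the maximal ideal of `R`. Then all maximal ideals of `T` are equal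
to `𝔪 ⊕ I`. -/
theorem mem_iff_of_isMaximal_of_prod (he : ∀ r, e (r, 0) = algebraMap R T r)
    (hsq : ∀ i, e (0, i) ^ 2 ∈ (maximalIdeal R).map (algebraMap R T))
    (P : Ideal T) [hP : P.IsMaximal] (r : R) (i : I) :
    e (r, i) ∈ P ↔ r ∈ maximalIdeal R := by
  have : Module.Finite R T := .equiv e
  have hcomap : P.comap (algebraMap R T) = maximalIdeal R :=
    eq_maximalIdeal (Ideal.isMaximal_comap_of_isIntegral_of_isMaximal P)
  -- `P` lies over `𝔪`, so it contains `𝔪T` and hence the square of this element.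
  have hmem : e (0, i) ∈ P :=
    hP.isPrime.mem_of_pow_mem 2 (Ideal.map_le_iff_le_comap.2 hcomap.ge (hsq i))
  have hadd : e (r, i) = algebraMap R T r + e (0, i) := by
    rw [← he, ← map_add, Prod.mk_add_mk, add_zero, zero_add]
  rw [hadd, P.add_mem_iff_left hmem, ← hcomap, Ideal.mem_comap]

/-- Such an algebra is Cohen–Macaulay iff the maximal ideal of `R` contains regular sequences of
length `dim R` on both `R` and `I`. -/
theorem isCohenMacaulayRing_iff_of_prod (he : ∀ r, e (r, 0) = algebraMap R T r)
    (hsq : ∀ i, e (0, i) ^ 2 ∈ (maximalIdeal R).map (algebraMap R T))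
    {d : ℕ} (hd : ringKrullDim R = d) :
    IsCohenMacaulayRing T ↔
      HasRegularSeq (maximalIdeal R) d (⊥ : Submodule R R) ∧
        HasRegularSeq (maximalIdeal R) d (⊥ : Submodule R I) := by
  have hfin : Module.Finite R T := .equiv e
  have hnt : Nontrivial T := e.symm.toEquiv.nontrivial
  have hnoeth : IsNoetherianRing T := IsNoetherianRing.of_finite R T
  have hmem := mem_iff_of_isMaximal_of_prod e he hsq
  have hinj : Function.Injective (algebraMap R T) := fun r s h => by
    rw [← he, ← he] at h
    exact congrArg Prod.fst (e.injective h)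
  have hloc : IsLocalRing T := by
    obtain ⟨P, hP⟩ := Ideal.exists_maximal T
    refine .of_unique_max_ideal ⟨P, hP, fun Q hQ => ?_⟩
    have hQ : Q.IsMaximal := hQ
    ext y
    obtain ⟨⟨r, i⟩, rfl⟩ := e.surjective y
    rw [hmem P, hmem Q]
  have hle : (maximalIdeal R).map (algebraMap R T) ≤ maximalIdeal T :=
    Ideal.map_le_iff_le_comap.2 fun r hr => by
      rw [Ideal.mem_comap, ← he, hmem]
      exact hr
  have hrad : maximalIdeal T ≤ ((maximalIdeal R).map (algebraMap R T)).radical := by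
    intro y hy
    obtain ⟨⟨r, i⟩, rfl⟩ := e.surjective y
    rw [hmem] at hy
    have hadd : e (r, i) = algebraMap R T r + e (0, i) := by
      rw [← he, ← map_add, Prod.mk_add_mk, add_zero, zero_add]
    rw [hadd]
    exact Ideal.add_mem _ (Ideal.le_radical (Ideal.mem_map_of_mem _ hy)) ⟨2, hsq i⟩
  rw [isCohenMacaulayRing_iff_hasRegularSeq ((ringKrullDim_eq_of_isIntegral hinj).trans hd),
    ← hasRegularSeq_restrictScalars_iff hle hrad, Submodule.restrictScalars_bot,
    ← e.hasRegularSeq_bot_iff, ← Submodule.prod_bot, HasRegularSeq.prod_iff]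

end FiniteExtension

/-! ### The module and ring structure of `R(I)_{a,b}` -/

namespace ReesQuotient

variable {R : Type*} [CommRing R] (I : Ideal R) (a b : R)

theorem monic_quadratic : (X ^ 2 + C a * X + C b : R[X]).Monic := by
  monicity!

/-- The `R`-linear map sending `(r, i)` to the class of `r + i t`. -/
noncomputable def ofProd : (R × I) →ₗ[R] ReesQuotient I a b :=
  (Ideal.Quotient.mkₐ R _).toLinearMap ∘ₗ
    LinearMap.codRestrict (Subalgebra.toSubmodule (reesAlgebra I))
      (LinearMap.coprod (monomial 0) (monomial 1 ∘ₗ I.subtype)) (by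
        rintro ⟨r, i⟩
        refine (reesAlgebra I).add_mem (reesAlgebra.monomial_mem.2 (by simp))
          (reesAlgebra.monomial_mem.2 ?_)
        simp)

theorem mk_eq_ofProd_iff {f : reesAlgebra I} {x : R × I} :
    Ideal.Quotient.mk _ f = ofProd I a b x ↔
      (X ^ 2 + C a * X + C b : R[X]) ∣ f.1 - (C x.1 + monomial 1 x.2.1) := by
  rw [← Ideal.mem_span_singleton]
  exact Ideal.Quotient.eq

theorem ofProd_injective [Nontrivial R] : Function.Injective (ofProd I a b) := by
  rw [injective_iff_map_eq_zero]
  rintro ⟨r, i⟩ h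
  have h0 : Ideal.Quotient.mk _ (0 : reesAlgebra I) = ofProd I a b (r, i) := by
    rw [h, map_zero]
  rw [mk_eq_ofProd_iff] at h0
  have hdvd : (X ^ 2 + C a * X + C b : R[X]) ∣ C r + monomial 1 i.1 := by
    simpa only [ZeroMemClass.coe_zero, zero_sub, dvd_neg] using h0
  have hz : C r + monomial 1 i.1 = 0 := by
    by_contra hne
    have hdeg : (X ^ 2 + C a * X + C b : R[X]).degree = 2 := by compute_degree!
    refine (monic_quadratic a b).not_dvd_of_degree_lt hne ?_ hdvd
    rw [hdeg]
    calc (C r + monomial 1 i.1).degree ≤ 1 := by compute_degree!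
      _ < 2 := by norm_num
  have h1 := congrArg (coeff · 0) hz
  have h2 := congrArg (coeff · 1) hz
  simp [coeff_monomial, coeff_C] at h1 h2
  simp [h1, h2]

/-- Reduce term by term: constants have no linear part, and for `n ≥ 1` the coefficient of `tⁿ` lies
in `Iⁿ ⊆ I`. -/
theorem coeff_one_modByMonic_mem {f : R[X]} (hf : f ∈ reesAlgebra I) [Nontrivial R] :
    (f %ₘ (X ^ 2 + C a * X + C b)).coeff 1 ∈ I := by
  set p : R[X] := X ^ 2 + C a * X + C b with hp
  have hlin : ∀ g : R[X], g %ₘ p = modByMonicHom p g := fun g => rfl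
  rw [f.as_sum_range, hlin, map_sum, finsetSum_coeff]
  refine I.sum_mem fun n _ => ?_
  obtain _ | n := n
  · have hC : C (f.coeff 0) %ₘ p = C (f.coeff 0) := by
      rw [modByMonic_eq_self_iff (monic_quadratic a b)]
      have hdeg : p.degree = 2 := by rw [hp]; compute_degree!
      rw [hdeg]
      exact degree_C_le.trans_lt (by norm_num)
    rw [monomial_zero_left, ← hlin, hC, coeff_C]
    simp
  · rw [← mul_one (f.coeff (n + 1)), ← smul_eq_mul, ← smul_monomial, map_smul, coeff_smul,
      smul_eq_mul]
    exact I.mul_mem_right _ (Ideal.pow_le_self n.succ_ne_zero (hf (n + 1)))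

theorem ofProd_surjective [Nontrivial R] : Function.Surjective (ofProd I a b) := by
  intro y
  obtain ⟨f, rfl⟩ := Ideal.Quotient.mk_surjective y
  set p : R[X] := X ^ 2 + C a * X + C b with hp
  refine ⟨((f.1 %ₘ p).coeff 0, ⟨_, coeff_one_modByMonic_mem I a b f.2⟩), ?_⟩
  rw [eq_comm, mk_eq_ofProd_iff]
  have hdeg : (f.1 %ₘ p).natDegree ≤ 1 := by
    have hnd : p.natDegree = 2 := by rw [hp]; compute_degree!
    have := natDegree_modByMonic_lt f.1 (q := p) (monic_quadratic a b) (by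
      intro h
      simp [h] at hnd)
    omega
  have hrem : C ((f.1 %ₘ p).coeff 0) + monomial 1 ((f.1 %ₘ p).coeff 1) = f.1 %ₘ p := by
    conv_rhs => rw [eq_X_add_C_of_natDegree_le_one hdeg]
    rw [add_comm, ← C_mul_X_eq_monomial]
  rw [hrem]
  exact ⟨f.1 /ₘ p, by rw [sub_eq_iff_eq_add', modByMonic_add_div f.1 p]⟩

/-- As an `R`-module, `R(I)_{a,b}` is `R ⊕ I`. -/
noncomputable def prodEquiv [Nontrivial R] : (R × I) ≃ₗ[R] ReesQuotient I a b :=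
  LinearEquiv.ofBijective (ofProd I a b) ⟨ofProd_injective I a b, ofProd_surjective I a b⟩

theorem ofProd_inl (r : R) : ofProd I a b (r, 0) = algebraMap R _ r := by
  change ofProd I a b (r, 0) = Ideal.Quotient.mk _ (algebraMap R (reesAlgebra I) r)
  rw [eq_comm, mk_eq_ofProd_iff]
  simp [algebraMap_eq]

/-- Only one factor `i` is pulled out, which is enough to put the square in `𝔪T` when `I ⊆ 𝔪`. -/
theorem ofProd_zero_mul_self (i : I) :
    ofProd I a b (0, i) * ofProd I a b (0, i) =
      algebraMap R _ i.1 * ofProd I a b (-(i.1 * b), -(a • i)) := by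
  rw [← Algebra.smul_def, ← map_smul]
  change Ideal.Quotient.mk _ (_ * _) = _
  rw [mk_eq_ofProd_iff]
  refine ⟨C (i.1 * i.1), ?_⟩
  change (monomial 0 0 + monomial 1 i.1) * (monomial 0 0 + monomial 1 i.1) - _ = _
  simp [← C_mul_X_eq_monomial]
  ring

theorem isCohenMacaulayRing_iff [IsLocalRing R] [IsNoetherianRing R] (hI : I ≠ ⊤) {d : ℕ}
    (hd : ringKrullDim R = d) :
    IsCohenMacaulayRing (ReesQuotient I a b) ↔
      HasRegularSeq (IsLocalRing.maximalIdeal R) d (⊥ : Submodule R R) ∧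
        HasRegularSeq (IsLocalRing.maximalIdeal R) d (⊥ : Submodule R I) := by
  refine isCohenMacaulayRing_iff_of_prod (prodEquiv I a b) (ofProd_inl I a b) (fun i => ?_) hd
  refine (congrArg (· ∈ _) ((pow_two _).trans (ofProd_zero_mul_self I a b i))).mpr ?_
  exact Ideal.mul_mem_right _ _ (Ideal.mem_map_of_mem _ (IsLocalRing.le_maximalIdeal hI i.2))

end ReesQuotient

theorem mainTheorem4 {R : Type*} [CommRing R] [IsLocalRing R] (hR : IsCohenMacaulayRing R)
    (d : ℕ) (hd : ringKrullDim R = d) (I : Ideal R) (hI : I ≠ ⊤) :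
    (I ≠ ⊥ → ∀ a b : R, IsCohenMacaulayRing (ReesQuotient I a b) ↔
      IsCohenMacaulayModule R I ∧ Module.supportDim R I = d) ∧
    (∀ a b a' b' : R, IsCohenMacaulayRing (ReesQuotient I a b) ↔
      IsCohenMacaulayRing (ReesQuotient I a' b')) := by
  have := hR.noetherian
  have hRd := (isCohenMacaulayRing_iff_hasRegularSeq hd).1 hR
  constructor
  · intro hI0 a b
    have : Nontrivial I := Submodule.nontrivial_iff_ne_bot.2 hI0
    rw [ReesQuotient.isCohenMacaulayRing_iff I a b hI hd, and_iff_right hRd]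
    constructor
    · intro h
      have hdim : Module.supportDim R I = d :=
        -- The regular sequence of length `d` itself forces `dim I ≥ d`.
        le_antisymm ((Module.supportDim_le_ringKrullDim R I).trans_eq hd) h.le_supportDim
      exact ⟨(isCohenMacaulayModule_iff_hasRegularSeq hdim).2 h, hdim⟩
    · rintro ⟨h, hdim⟩
      exact (isCohenMacaulayModule_iff_hasRegularSeq hdim).1 h
  -- The criterion does not involve `a`, `b`, and it covers `I = 0` since only weak regularity is
  -- asked.
  · intro a b a' b'
    rw [ReesQuotient.isCohenMacaulayRing_iff I a b hI hd,
      ReesQuotient.isCohenMacaulayRing_iff I a' b' hI hd]
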